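/- Let $K$ be a finite (abstract) simplicial complex whose vertices are totally ordered, and let $K_q$ be its set of $q$-dimensional (nonempty) simplices. Fix an orientation of every simplex of $K$, arbitrarily chosen, and for a codimension-one face $\alpha\prec\sigma$ let $[\sigma:\alpha]=\pm1$ be the incidence number: if all simplices are oriented by the increasing order of their vertices and $\alpha$ is obtained from $\sigma$ by deleting its $i$-th vertex (counting from $0$), then $[\sigma:\alpha]=(-1)^i$; reversing the orientation of $\sigma$ or of $\alpha$ changes the sign. Let $f:K\to\mathbb{R}$ be a discrete Morse function, that is, for every $\sigma\in K_p$ there is at most one $\tau^{(p+1)}\succ\sigma$ with $f(\tau)\le f(\sigma)$ and at most one $\nu^{(p-1)}\prec\sigma$ with $f(\sigma)\le f(\nu)$. The simplex $\sigma$ is critical if there is no such $\tau$ and no such $\nu$; let $Cr_q(f)\subseteq K_q$ be the set of critical $q$-simplices. A gradient pair is a pair $(\alpha^{(p)},\beta^{(p+1)})$ with $\alpha\prec\beta$ and $f(\alpha)\ge f(\beta)$. For $\sigma\in Cr_q(f)$ and $\alpha\in Cr_{q-1}(f)$, a gradient path $\gamma$ from $\sigma$ to $\alpha$ is a sequence $$\sigma,\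 \alpha_0^{(q-1)},\beta_0^{(q)},\alpha_1^{(q-1)},\dots,\beta_{r-1}^{(q)},\alpha_r^{(q-1)}=\alpha\qquad(r\ge 0)$$ with $\alpha_0\prec\sigma$ such that, for $0\le i<r$, $(\alpha_i,\beta_i)$ is a gradient pair, $\alpha_{i+1}\prec\beta_i$ and $\alpha_{i+1}\ne\alpha_i$. Its multiplicity is $$m(\gamma)=[\sigma:\alpha_0]\prod_{i=0}^{r-1}\bigl(-[\beta_i:\alpha_i]\,[\beta_i:\alpha_{i+1}]\bigr).$$ Let $n^f(\sigma,\alpha)=\sum_\gamma m(\gamma)$, a sum over the finitely many gradient paths from $\sigma$ to $\alpha$. Let $C_q^f$ be the $\mathbb{Q}$-vector space with basis $Cr_q(f)$, and let $\partial_q^f:C_q^f\to C_{q-1}^f$ be the linear map with $\partial_q^f(\sigma)=\sum_{\alpha\in Cr_{q-1}(f)}n^f(\sigma,\alpha)\,\alpha$ for $q\ge1$, and $\partial_0^f=0$. Then $\partial_q^f\circ\partial_{q+1}^f=0$ for every $q\ge0$, and for every $q\ge 0$ the discrete Morse homology $H_q^f=\ker\partial_q^f/\operatorname{im}\partial_{q+1}^f$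 is isomorphic over $\mathbb{Q}$ to the simplicial homology, $$H_q^f\;\cong\;H_q^{\mathrm{simp}}(K;\mathbb{Q}),$$ where $H_q^{\mathrm{simp}}(K;\mathbb{Q})$ is the homology of the complex of $\mathbb{Q}$-vector spaces with bases $K_q$ and boundary $\sigma\mapsto\sum_{\alpha^{(q-1)}\prec\sigma}[\sigma:\alpha]\,\alpha$ (zero on $K_0$). -/

import Mathlib

namespace DiscreteMorse

universe u

variable {ι : Type u} {K : PreAbstractSimplicialComplex ι}

/-- `α` is a codimension-one face of `β`, for simplices `α`, `β` of `K`
(the simplices of `K` are nonempty, so vertices have no codimension-one face). -/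
def IsFacet (α β : K.faces) : Prop :=
  α.1 ⊆ β.1 ∧ β.1.card = α.1.card + 1

/-- The codimension-one cofaces `τ` of `σ` with `f τ ≤ f σ`. -/
def exceptionalCofaces (f : K.faces → ℝ) (σ : K.faces) : Set K.faces :=
  {τ | IsFacet σ τ ∧ f τ ≤ f σ}

/-- The codimension-one faces `ν` of `σ` with `f σ ≤ f ν`. -/
def exceptionalFaces (f : K.faces → ℝ) (σ : K.faces) : Set K.faces :=
  {ν | IsFacet ν σ ∧ f σ ≤ f ν}

/-- Discrete Morse functions on `K`. -/
def IsDiscreteMorse (f : K.faces → ℝ) : Prop :=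
  ∀ σ : K.faces, (exceptionalCofaces f σ).encard ≤ 1 ∧ (exceptionalFaces f σ).encard ≤ 1

/-- Critical simplices of `f`. -/
def IsCritical (f : K.faces → ℝ) (σ : K.faces) : Prop :=
  (exceptionalCofaces f σ).encard = 0 ∧ (exceptionalFaces f σ).encard = 0

/-- `(α, β)` belongs to the gradient vector field of `f`. -/
def IsGradientPair (f : K.faces → ℝ) (α β : K.faces) : Prop :=
  IsFacet α β ∧ f β ≤ f α

/-- Gradient paths `α₀, β₀, α₁, β₁, …, βᵣ, αᵣ₊₁` of `f` from the first to the second argument: every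
`(αᵢ, βᵢ)` is a gradient pair, `αᵢ₊₁` is a codimension-one face of `βᵢ`, and `αᵢ₊₁ ≠ αᵢ`. The
constant path at `α` is included. -/
inductive GradientPath (f : K.faces → ℝ) : K.faces → K.faces → Type u
  | nil (α : K.faces) : GradientPath f α α
  | cons {α α' ω : K.faces} (β : K.faces) (pair : IsGradientPair f α β) (face : IsFacet α' β)
      (ne : α' ≠ α) (γ : GradientPath f α' ω) : GradientPath f α ω

/-- Gradient paths `σ, α₀, β₀, α₁, …, ω` of `f` that start at a simplex `σ` of one dimension higher:
a codimension-one face `α₀` of `σ`, followed by a gradient path from `α₀` to `ω`. -/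
def DescendingPath (f : K.faces → ℝ) (σ ω : K.faces) : Type u :=
  Σ α : {α : K.faces // IsFacet α σ}, GradientPath f α.1 ω

/-- A choice of orientation of each simplex of `K`, recorded as a sign relative to the
orientation given by the increasing order of the vertices. -/
abbrev Orientation (K : PreAbstractSimplicialComplex ι) : Type u := K.faces → ℤˣ

open Classical in
/-- The incidence number `[σ : α]`. If `α` arises from `σ` by deleting the vertex `v`, it is
`(-1) ^ i` for the increasing orientations, where `i` is the number of vertices of `σ` that precede
`v`, and it is multiplied by the signs of the chosen orientations of `σ` and `α`.
It is zero if `α` is not a codimension-one face of `σ`. -/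
noncomputable def incidence [LinearOrder ι] (o : Orientation K) (σ α : K.faces) : ℤ :=
  if IsFacet α σ then
    (o σ : ℤ) * (o α : ℤ) * ∏ v ∈ σ.1 \ α.1, (-1) ^ (σ.1.filter (fun w => w < v)).card
  else 0

/-- The multiplicity of a gradient path: each step `α, β, α'` contributes
`-[β : α] [β : α']`. -/
noncomputable def GradientPath.weight [LinearOrder ι] (o : Orientation K) {f : K.faces → ℝ} :
    {α ω : K.faces} → GradientPath f α ω → ℤ
  | _, _, .nil _ => 1
  | _, _, .cons (α := α) (α' := α') β _ _ _ γ =>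
      -(incidence o β α * incidence o β α') * GradientPath.weight o γ

/-- The multiplicity of a gradient path `σ, α₀, …, ω`: the initial step contributes `[σ : α₀]`. -/
noncomputable def DescendingPath.weight [LinearOrder ι] (o : Orientation K) {f : K.faces → ℝ}
    {σ ω : K.faces} (γ : DescendingPath f σ ω) : ℤ :=
  incidence o σ γ.1.1 * γ.2.weight o

/-- The connectedness coefficient `n^f(σ, ω)`, the sum of the multiplicities of all gradient paths
from `σ` to `ω`. There are finitely many of them when `f` is a discrete Morse function on a finite
complex, see `finite_descendingPath`. -/
noncomputable def connectedness [LinearOrder ι] (o : Orientation K) (f : K.faces → ℝ)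
    (σ ω : K.faces) : ℤ :=
  ∑ᶠ γ : DescendingPath f σ ω, γ.weight o

/-- The simplices of `K` of dimension `q`. -/
def Simplex (K : PreAbstractSimplicialComplex ι) (q : ℕ) : Type u :=
  {σ : K.faces // σ.1.card = q + 1}

/-- The critical simplices of `f` of dimension `q`. -/
def Crit (f : K.faces → ℝ) (q : ℕ) : Type u :=
  {σ : K.faces // σ.1.card = q + 1 ∧ IsCritical f σ}

/-- Rational simplicial `q`-chains. -/
abbrev SimplicialChain (K : PreAbstractSimplicialComplex ι) (q : ℕ) : Type u := Simplex K q →₀ ℚ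

/-- Rational `q`-chains of the discrete Morse complex. -/
abbrev MorseChain (f : K.faces → ℝ) (q : ℕ) : Type u := Crit f q →₀ ℚ

/-- The simplicial boundary map `∂_q : C_q → C_{q-1}`, `σ ↦ ∑ [σ : α] α`, with `∂_0 = 0`. -/
noncomputable def simplicialBoundary [LinearOrder ι] (o : Orientation K) :
    (q : ℕ) → SimplicialChain K q →ₗ[ℚ] SimplicialChain K (q - 1)
  | 0 => 0
  | q + 1 => Finsupp.linearCombination ℚ fun σ : Simplex K (q + 1) =>
      ∑ᶠ α : Simplex K q, Finsupp.single α (incidence o σ.1 α.1 : ℚ)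

/-- The boundary map `∂_q : C_q^f → C_{q-1}^f` of the discrete Morse complex,
`σ ↦ ∑ n^f(σ, α) α`, with `∂_0 = 0`. -/
noncomputable def morseBoundary [LinearOrder ι] (o : Orientation K) (f : K.faces → ℝ) :
    (q : ℕ) → MorseChain f q →ₗ[ℚ] MorseChain f (q - 1)
  | 0 => 0
  | q + 1 => Finsupp.linearCombination ℚ fun σ : Crit f (q + 1) =>
      ∑ᶠ α : Crit f q, Finsupp.single α (connectedness o f σ.1 α.1 : ℚ)

/-- Rational simplicial homology `ker ∂_q / im ∂_{q+1}`. -/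
abbrev SimplicialHomology [LinearOrder ι] (o : Orientation K) (q : ℕ) : Type u :=
  (LinearMap.ker (simplicialBoundary o q)) ⧸
    (LinearMap.range (simplicialBoundary o (q + 1))).submoduleOf
      (LinearMap.ker (simplicialBoundary o q))

/-- Rational discrete Morse homology `ker ∂_q^f / im ∂_{q+1}^f`. -/
abbrev MorseHomology [LinearOrder ι] (o : Orientation K) (f : K.faces → ℝ) (q : ℕ) : Type u :=
  (LinearMap.ker (morseBoundary o f q)) ⧸
    (LinearMap.range (morseBoundary o f (q + 1))).submoduleOf
      (LinearMap.ker (morseBoundary o f q))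

theorem lt_of_step {f : K.faces → ℝ} (hf : IsDiscreteMorse f) {α α' β : K.faces}
    (pair : IsGradientPair f α β) (face : IsFacet α' β) (ne : α' ≠ α) : f α' < f α := by
  by_contra h
  exact ne (Set.encard_le_one_iff.mp (hf β).2 α' α ⟨face, pair.2.trans (not_lt.mp h)⟩ pair)

theorem finite_gradientPath [Finite K.faces] {f : K.faces → ℝ} (hf : IsDiscreteMorse f)
    (ω : K.faces) (α : K.faces) : Finite (GradientPath f α ω) := by
  have wf : WellFounded (fun a b : K.faces => f a < f b) :=
    @Finite.wellFounded_of_trans_of_irrefl K.faces _ (fun a b => f a < f b)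
      ⟨fun _ _ _ h h' => lt_trans h h'⟩ ⟨fun _ => lt_irrefl _⟩
  induction α using wf.induction with
  | _ α ih =>
    have : ∀ p : K.faces × {α' : K.faces // f α' < f α}, Finite (GradientPath f p.2.1 ω) :=
      fun p => ih _ p.2.2
    let g : GradientPath f α ω → Option
        (Σ p : K.faces × {α' : K.faces // f α' < f α}, GradientPath f p.2.1 ω)
      | .nil _ => none
      | .cons (α' := α') β pair face ne γ => some ⟨(β, ⟨α', lt_of_step hf pair face ne⟩), γ⟩
    refine Finite.of_injective g ?_
    intro x y hxy
    cases x with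
    | nil =>
      cases y with
      | nil => rfl
      | cons => simp [g] at hxy
    | cons β pair face ne γ =>
      cases y with
      | nil => simp [g] at hxy
      | cons β' pair' face' ne' γ' =>
        simp only [g, Option.some.injEq, Sigma.mk.injEq, Prod.mk.injEq, Subtype.mk.injEq] at hxy
        obtain ⟨⟨rfl, rfl⟩, h⟩ := hxy
        cases h
        rfl

theorem finite_descendingPath [Finite K.faces] {f : K.faces → ℝ} (hf : IsDiscreteMorse f)
    (σ ω : K.faces) : Finite (DescendingPath f σ ω) := by
  have : ∀ α : {α : K.faces // IsFacet α σ}, Finite (GradientPath f α.1 ω) :=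
    fun α => finite_gradientPath hf ω α.1
  unfold DescendingPath
  infer_instance

end DiscreteMorse

namespace DiscreteMorse

universe u

/-! The Morse complex is a quotient of the simplicial complex by an acyclic subcomplex. The quotient
map is `reduction`: it sends a simplex to the weighted sum of the critical simplices reached from it
by gradient paths. Let `U_q` be the span of the upper simplices of gradient pairs. Since an upper
simplex is never a lower one (`IsGradientPair.not_isGradientPair`), no gradient path leads from it
to a critical simplex, so `reduction` kills `U_q`. The first-step recursion for path sums shows that
it also kills `∂ U_{q+1}` (`sum_incidence_mul_pathSum`), and on critical chains it is the identity.
Induction on the value of `f` shows that critical chains, `U_q` and `∂ U_{q+1}` together span all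
chains (`exists_decomposition`). Checked on these three pieces, `reduction` is a chain map, and its
kernel is `U_q + ∂ U_{q+1}`. As `∂` is injective on `U_q` (`eq_zero_of_simplicialBoundary_eq_zero`),
that kernel is acyclic. Surjectivity then gives both `∂^f ∂^f = 0` and the isomorphism in homology.
-/

/-- A surjective chain map with acyclic kernel induces an isomorphism in homology; only the part of
the complexes around one degree is recorded. -/
theorem nonempty_homology_equiv {R C₂ C₁ C₀ D₂ D₁ D₀ : Type*} [Ring R]
    [AddCommGroup C₂] [AddCommGroup C₁] [AddCommGroup C₀]
    [AddCommGroup D₂] [AddCommGroup D₁] [AddCommGroup D₀]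
    [Module R C₂] [Module R C₁] [Module R C₀] [Module R D₂] [Module R D₁] [Module R D₀]
    {c₂ : C₂ →ₗ[R] C₁} {c₁ : C₁ →ₗ[R] C₀} {d₂ : D₂ →ₗ[R] D₁} {d₁ : D₁ →ₗ[R] D₀}
    {r₂ : C₂ →ₗ[R] D₂} {r₁ : C₁ →ₗ[R] D₁} {r₀ : C₀ →ₗ[R] D₀}
    (h₂ : ∀ x, d₂ (r₂ x) = r₁ (c₂ x)) (h₁ : ∀ x, d₁ (r₁ x) = r₀ (c₁ x))
    (s₂ : Function.Surjective r₂) (s₁ : Function.Surjective r₁)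
    (hc : ∀ x, c₁ (c₂ x) = 0)
    (e₁ : ∀ x, r₁ x = 0 → c₁ x = 0 → ∃ y, r₂ y = 0 ∧ c₂ y = x)
    (e₀ : ∀ x, r₀ (c₁ x) = 0 → ∃ y, r₁ y = 0 ∧ c₁ y = c₁ x) :
    Nonempty ((LinearMap.ker d₁ ⧸ (LinearMap.range d₂).submoduleOf (LinearMap.ker d₁)) ≃ₗ[R]
      (LinearMap.ker c₁ ⧸ (LinearMap.range c₂).submoduleOf (LinearMap.ker c₁))) := by
  let r : LinearMap.ker c₁ →ₗ[R] LinearMap.ker d₁ := r₁.restrict fun x hx => by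
    simp only [LinearMap.mem_ker] at hx ⊢
    rw [h₁, hx, map_zero]
  let φ := ((LinearMap.range d₂).submoduleOf (LinearMap.ker d₁)).mkQ ∘ₗ r
  have hr (x : LinearMap.ker c₁) : (r x : D₁) = r₁ x := rfl
  have hφ : Function.Surjective φ := by
    refine (Submodule.mkQ_surjective _).comp ?_
    rintro ⟨y, hy⟩
    obtain ⟨z, rfl⟩ := s₁ y
    -- A lift `z` of a cycle need not be a cycle; subtracting a kernel element with the same
    -- boundary makes it one.
    obtain ⟨w, hw, hwz⟩ := e₀ z (by rw [← h₁]; exact hy)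
    refine ⟨⟨z - w, by simp [hwz]⟩, Subtype.ext ?_⟩
    simp [hr, hw]
  have hk : LinearMap.ker φ = (LinearMap.range c₂).submoduleOf (LinearMap.ker c₁) := by
    ext ⟨x, hx⟩
    have h : φ ⟨x, hx⟩ = 0 ↔ r₁ x ∈ LinearMap.range d₂ := Submodule.Quotient.mk_eq_zero _
    rw [LinearMap.mem_ker, h]
    change _ ↔ x ∈ LinearMap.range c₂
    rw [LinearMap.mem_ker] at hx
    constructor
    · rintro ⟨y, hy⟩
      obtain ⟨z, rfl⟩ := s₂ y
      obtain ⟨w, -, hw⟩ := e₁ (x - c₂ z) (by rw [map_sub, ← h₂, hy, sub_self])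
        (by rw [map_sub, hc, hx, sub_zero])
      exact ⟨w + z, by rw [map_add, hw, sub_add_cancel]⟩
    · rintro ⟨y, rfl⟩
      exact ⟨r₂ y, h₂ y⟩
  exact ⟨((Submodule.quotEquivOfEq _ _ hk).symm.trans (φ.quotKerEquivOfSurjective hφ)).symm⟩

variable {ι : Type u} {K : PreAbstractSimplicialComplex ι}

theorem coe_mul_coe_self (u : ℤˣ) : (u : ℤ) * u = 1 := by
  rw [← Units.val_mul, Int.units_mul_self, Units.val_one]

/-! ### Incidence numbers and the identity `∂ ∂ = 0`. -/

section Facets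

theorem isFacet_iff_eq_erase [DecidableEq ι] {α σ : K.faces} :
    IsFacet α σ ↔ ∃ v ∈ σ.1, α.1 = σ.1.erase v := by
  constructor
  · rintro ⟨h, hc⟩
    have h1 : (σ.1 \ α.1).card = 1 := by
      rw [Finset.card_sdiff_of_subset h]; omega
    obtain ⟨v, hv⟩ := Finset.card_eq_one.mp h1
    have hv' : v ∈ σ.1 ∧ v ∉ α.1 := by
      rw [← Finset.mem_sdiff, hv]; exact Finset.mem_singleton_self v
    refine ⟨v, hv'.1, Finset.eq_of_subset_of_card_le ?_ ?_⟩
    · exact Finset.subset_erase.mpr ⟨h, hv'.2⟩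
    · rw [Finset.card_erase_of_mem hv'.1]; omega
  · rintro ⟨v, hv, h⟩
    refine ⟨h ▸ Finset.erase_subset _ _, ?_⟩
    rw [h, Finset.card_erase_add_one hv]

/-- The sign attached to deleting the vertex `v` from `s`. -/
def deletionSign [LinearOrder ι] (s : Finset ι) (v : ι) : ℤ :=
  (-1) ^ (s.filter (fun w => w < v)).card

/-- Deleting `v` lowers the position of the later vertex `w` by one, while deleting `w` leaves the
position of `v` unchanged. -/
theorem deletionSign_mul_add_of_lt [LinearOrder ι] {s : Finset ι} {v w : ι}
    (hv : v ∈ s) (h : v < w) :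
    deletionSign s v * deletionSign (s.erase v) w +
      deletionSign s w * deletionSign (s.erase w) v = 0 := by
  have h1 : (s.erase w).filter (fun x => x < v) = s.filter (fun x => x < v) := by
    ext x
    simp only [Finset.mem_filter, Finset.mem_erase]
    exact ⟨fun hx => ⟨hx.1.2, hx.2⟩, fun hx => ⟨⟨(hx.2.trans h).ne, hx.1⟩, hx.2⟩⟩
  have h2 : (s.filter (fun x => x < w)).card =
      ((s.erase v).filter (fun x => x < w)).card + 1 := by
    rw [Finset.filter_erase, Finset.card_erase_add_one (Finset.mem_filter.mpr ⟨hv, h⟩)]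
  simp only [deletionSign, h1, h2, pow_succ]
  ring

theorem deletionSign_mul_add [LinearOrder ι] {s : Finset ι} {v w : ι}
    (hv : v ∈ s) (hw : w ∈ s) (h : v ≠ w) :
    deletionSign s v * deletionSign (s.erase v) w +
      deletionSign s w * deletionSign (s.erase w) v = 0 := by
  rcases lt_or_gt_of_ne h with h | h
  · exact deletionSign_mul_add_of_lt hv h
  · rw [add_comm]; exact deletionSign_mul_add_of_lt hw h

theorem incidence_eq [LinearOrder ι] (o : Orientation K) {σ α : K.faces} {v : ι} (hv : v ∈ σ.1)
    (h : α.1 = σ.1.erase v) :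
    incidence o σ α = (o σ : ℤ) * (o α : ℤ) * deletionSign σ.1 v := by
  classical
  have hd : σ.1 \ α.1 = {v} := by
    rw [h]; ext x; simp only [Finset.mem_sdiff, Finset.mem_erase, Finset.mem_singleton]
    constructor
    · tauto
    · rintro rfl; tauto
  rw [incidence, if_pos (isFacet_iff_eq_erase.mpr ⟨v, hv, h⟩)]
  congr 1
  rw [deletionSign]
  convert Finset.prod_singleton _ v using 2

theorem incidence_of_not_isFacet [LinearOrder ι] (o : Orientation K) {σ α : K.faces}
    (h : ¬ IsFacet α σ) : incidence o σ α = 0 := if_neg h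

theorem incidence_mul_self [LinearOrder ι] (o : Orientation K) {σ α : K.faces}
    (h : IsFacet α σ) : incidence o σ α * incidence o σ α = 1 := by
  obtain ⟨v, hv, hα⟩ := isFacet_iff_eq_erase.mp h
  rw [incidence_eq o hv hα, deletionSign]
  have h1 : ((o σ : ℤ)) * (o σ : ℤ) = 1 := coe_mul_coe_self _
  have h2 : ((o α : ℤ)) * (o α : ℤ) = 1 := coe_mul_coe_self _
  generalize (Finset.filter (fun w => w < v) σ.1).card = n
  have h3 : ((-1 : ℤ) ^ n) * (-1) ^ n = 1 := by rw [← mul_pow]; simp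
  calc _ = ((o σ : ℤ) * o σ) * ((o α : ℤ) * o α) * ((-1 : ℤ) ^ n * (-1) ^ n) := by ring
    _ = 1 := by rw [h1, h2, h3]; rfl

theorem incidence_ne_zero [LinearOrder ι] (o : Orientation K) {σ α : K.faces}
    (h : IsFacet α σ) : incidence o σ α ≠ 0 := fun h0 => by
  simpa [h0] using incidence_mul_self o h

/-- A nonempty subset of a simplex is a simplex. -/
def subface (σ : K.faces) {t : Finset ι} (h : t ⊆ σ.1) (ht : t.Nonempty) : K.faces :=
  ⟨t, (K.isRelLowerSet_faces σ.2).2 h ht⟩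

/-- Two simplices of codimension two in each other have exactly two simplices in between. -/
theorem exists_intermediate [DecidableEq ι] {τ σ : K.faces} (h : τ.1 ⊆ σ.1)
    (hc : σ.1.card = τ.1.card + 2) : ∃ (v w : ι) (α β : K.faces), v ≠ w ∧ v ∈ σ.1 ∧ w ∈ σ.1 ∧
      α.1 = σ.1.erase v ∧ β.1 = σ.1.erase w ∧ τ.1 = α.1.erase w ∧ τ.1 = β.1.erase v ∧
      ∀ ξ : K.faces, IsFacet ξ σ → IsFacet τ ξ → ξ = α ∨ ξ = β := by
  have h2 : (σ.1 \ τ.1).card = 2 := by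
    rw [Finset.card_sdiff_of_subset h]; omega
  obtain ⟨v, w, hvw, hd⟩ := Finset.card_eq_two.mp h2
  have hd' (x : ι) : x ∈ σ.1 ∧ x ∉ τ.1 ↔ x = v ∨ x = w := by
    rw [← Finset.mem_sdiff, hd]; simp
  have hv := (hd' v).mpr (Or.inl rfl)
  have hw := (hd' w).mpr (Or.inr rfl)
  have hτ : τ.1.Nonempty := (K.isRelLowerSet_faces τ.2).1
  have ne (x : ι) (hx : x ∉ τ.1) : (σ.1.erase x).Nonempty :=
    hτ.mono (Finset.subset_erase.mpr ⟨h, hx⟩)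
  refine ⟨v, w, subface σ (Finset.erase_subset v _) (ne v hv.2),
    subface σ (Finset.erase_subset w _) (ne w hw.2), hvw, hv.1, hw.1, rfl, rfl, ?_, ?_, ?_⟩
  · ext x
    have := hd' x
    have := @h x
    simp only [subface, Finset.mem_erase]
    tauto
  · ext x
    have := hd' x
    have := @h x
    simp only [subface, Finset.mem_erase]
    tauto
  · intro ξ hξ hτξ
    obtain ⟨x, hx, hξx⟩ := isFacet_iff_eq_erase.mp hξ
    have hxτ : x ∉ τ.1 := fun hm => by
      have := hτξ.1 hm
      simp [hξx] at this
    rcases (hd' x).mp ⟨hx, hxτ⟩ with rfl | rfl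
    · exact Or.inl (Subtype.ext hξx)
    · exact Or.inr (Subtype.ext hξx)

noncomputable instance [Finite K.faces] : Fintype K.faces := Fintype.ofFinite _

/-- Only the two simplices strictly between `τ` and `σ` contribute. Their deletion signs are
opposite, and the orientation sign of the intermediate simplex occurs squared, so it drops out. -/
theorem sum_incidence_mul_incidence [LinearOrder ι] [Finite K.faces] (o : Orientation K)
    (σ τ : K.faces) : ∑ α : K.faces, incidence o σ α * incidence o α τ = 0 := by
  by_cases h : τ.1 ⊆ σ.1 ∧ σ.1.card = τ.1.card + 2
  · obtain ⟨v, w, α, β, hvw, hv, hw, hα, hβ, hτα, hτβ, hall⟩ := exists_intermediate h.1 h.2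
    have hαβ : α ≠ β := by
      intro e
      have : v ∈ β.1 := by rw [hβ]; exact Finset.mem_erase.mpr ⟨hvw, hv⟩
      rw [← e, hα] at this
      simp at this
    rw [Fintype.sum_eq_add α β hαβ]
    · have hwα : w ∈ α.1 := by rw [hα]; exact Finset.mem_erase.mpr ⟨hvw.symm, hw⟩
      have hvβ : v ∈ β.1 := by rw [hβ]; exact Finset.mem_erase.mpr ⟨hvw, hv⟩
      rw [incidence_eq o hv hα, incidence_eq o hw hβ, incidence_eq o hwα hτα,
        incidence_eq o hvβ hτβ, hα, hβ]
      have hs := deletionSign_mul_add hv hw hvw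
      have h1 : ((o α : ℤ)) * (o α : ℤ) = 1 := coe_mul_coe_self _
      have h2 : ((o β : ℤ)) * (o β : ℤ) = 1 := coe_mul_coe_self _
      linear_combination (o σ : ℤ) * (o τ : ℤ) * (hs +
        deletionSign σ.1 v * deletionSign (σ.1.erase v) w * h1 +
        deletionSign σ.1 w * deletionSign (σ.1.erase w) v * h2)
    · rintro ξ ⟨h1, h2⟩
      by_cases hξ : IsFacet ξ σ
      · by_cases hτ : IsFacet τ ξ
        · rcases hall ξ hξ hτ with rfl | rfl <;> contradiction
        · rw [incidence_of_not_isFacet o hτ, mul_zero]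
      · rw [incidence_of_not_isFacet o hξ, zero_mul]
  · refine Finset.sum_eq_zero fun α _ => ?_
    by_cases hξ : IsFacet α σ
    · by_cases hτ : IsFacet τ α
      · exact (h ⟨hτ.1.trans hξ.1, by rw [hξ.2, hτ.2]⟩).elim
      · rw [incidence_of_not_isFacet o hτ, mul_zero]
    · rw [incidence_of_not_isFacet o hξ, zero_mul]

end Facets

/-! ### Gradient pairs form a matching. -/

section Pairs

variable {f : K.faces → ℝ}

theorem IsGradientPair.right_unique (hf : IsDiscreteMorse f) {α β β' : K.faces}
    (h : IsGradientPair f α β) (h' : IsGradientPair f α β') : β = β' :=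
  Set.encard_le_one_iff.mp (hf α).1 β β' h h'

theorem IsGradientPair.left_unique (hf : IsDiscreteMorse f) {α α' β : K.faces}
    (h : IsGradientPair f α β) (h' : IsGradientPair f α' β) : α = α' :=
  Set.encard_le_one_iff.mp (hf β).2 α α' h h'

/-- If both were pairs, an intermediate simplex `ξ ≠ σ` would satisfy `f ν < f ξ < f τ ≤ f σ ≤ f ν`.
So `σ` would be the only intermediate simplex, but there are two. -/
theorem IsGradientPair.not_isGradientPair (hf : IsDiscreteMorse f) {ν σ τ : K.faces}
    (h : IsGradientPair f ν σ) : ¬ IsGradientPair f σ τ := fun h' => by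
  classical
  obtain ⟨v, w, α, β, hvw, hv, hw, hα, hβ, hτα, hτβ, -⟩ :=
    exists_intermediate (h.1.1.trans h'.1.1) (by rw [h'.1.2, h.1.2])
  have hwα : w ∈ α.1 := by rw [hα]; exact Finset.mem_erase.mpr ⟨hvw.symm, hw⟩
  have hvβ : v ∈ β.1 := by rw [hβ]; exact Finset.mem_erase.mpr ⟨hvw, hv⟩
  have hαβ : α ≠ β := by
    rintro rfl
    rw [hα] at hvβ
    simp at hvβ
  have key (ξ : K.faces) (h1 : IsFacet ξ τ) (h2 : IsFacet ν ξ) : ξ = σ := by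
    by_contra hne
    have h3 : f ν < f ξ := by
      by_contra hlt
      exact hne (IsGradientPair.right_unique hf ⟨h2, not_lt.mp hlt⟩ h)
    have h4 : f ξ < f τ := by
      by_contra hlt
      exact hne (IsGradientPair.left_unique hf ⟨h1, not_lt.mp hlt⟩ h')
    have := h.2
    have := h'.2
    linarith
  refine hαβ ((key α ?_ ?_).trans (key β ?_ ?_).symm) <;> rw [isFacet_iff_eq_erase]
  exacts [⟨v, hv, hα⟩, ⟨w, hwα, hτα⟩, ⟨w, hw, hβ⟩, ⟨v, hvβ, hτβ⟩]

theorem isCritical_iff {σ : K.faces} : IsCritical f σ ↔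
    (∀ τ, ¬ IsGradientPair f σ τ) ∧ ∀ ν, ¬ IsGradientPair f ν σ := by
  simp only [IsCritical, Set.encard_eq_zero, Set.eq_empty_iff_forall_notMem]
  rfl

/-- Prolonging a path by a gradient pair at its start. -/
def consPath {α β : K.faces} (pair : IsGradientPair f α β) (ω : K.faces)
    (p : Σ α' : {α' : K.faces // IsFacet α' β ∧ α' ≠ α}, GradientPath f α'.1 ω) :
    GradientPath f α ω :=
  .cons β pair p.1.2.1 p.1.2.2 p.2

theorem consPath_bijective (hf : IsDiscreteMorse f) {α β ω : K.faces}
    (pair : IsGradientPair f α β) (hne : α ≠ ω) : Function.Bijective (consPath pair ω) := by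
  constructor
  · rintro ⟨⟨α', h'⟩, γ'⟩ ⟨⟨α'', h''⟩, γ''⟩ h
    simp only [consPath, GradientPath.cons.injEq, true_and] at h
    obtain ⟨rfl, h⟩ := h
    cases h
    rfl
  · intro γ
    cases γ with
    | nil => exact (hne rfl).elim
    | cons β' pair' face ne γ =>
      obtain rfl := pair.right_unique hf pair'
      exact ⟨⟨⟨_, face, ne⟩, γ⟩, rfl⟩

end Pairs

/-! ### Weighted sums over gradient paths. -/

section PathSum

variable [LinearOrder ι] (o : Orientation K) {f : K.faces → ℝ}

/-- The sum of the multiplicities of the gradient paths from `α` to `ω`. -/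
noncomputable def pathSum (f : K.faces → ℝ) (α ω : K.faces) : ℤ :=
  ∑ᶠ γ : GradientPath f α ω, γ.weight o

theorem pathSum_self {α : K.faces} (h : ∀ β, ¬ IsGradientPair f α β) :
    pathSum o f α α = 1 := by
  rw [pathSum, finsum_eq_single _ (GradientPath.nil α)]
  · simp [GradientPath.weight]
  · intro γ hγ
    cases γ with
    | nil => exact (hγ rfl).elim
    | cons β pair => exact (h β pair).elim

theorem pathSum_of_ne {α ω : K.faces} (h : ∀ β, ¬ IsGradientPair f α β) (hne : α ≠ ω) :
    pathSum o f α ω = 0 := by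
  have : IsEmpty (GradientPath f α ω) := ⟨fun γ => by
    cases γ with
    | nil => exact hne rfl
    | cons β pair => exact h β pair⟩
  exact finsum_of_isEmpty _

/-- Recursion on the first step: as `α ≠ ω` the path is not constant, and its first upper simplex
must be `β`. Non-faces `α'` of `β` contribute zero through the incidence number. -/
theorem pathSum_eq_sum [Finite K.faces] (hf : IsDiscreteMorse f) {α β ω : K.faces}
    (pair : IsGradientPair f α β) (hne : α ≠ ω) :
    pathSum o f α ω = ∑ α' : {α' : K.faces // α' ≠ α},
      -(incidence o β α * incidence o β α') * pathSum o f α'.1 ω := by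
  classical
  have (α' : K.faces) : Fintype (GradientPath f α' ω) :=
    @Fintype.ofFinite _ (finite_gradientPath hf ω α')
  have e : ∑ α' : {α' : K.faces // α' ≠ α},
      -(incidence o β α * incidence o β α') * pathSum o f α'.1 ω =
      ∑ α' : {α' : K.faces // IsFacet α' β ∧ α' ≠ α},
      -(incidence o β α * incidence o β α') * pathSum o f α'.1 ω := by
    symm
    refine Fintype.sum_of_injective (fun x => ⟨x.1, x.2.2⟩) ?_ _ _ ?_ fun _ => rfl
    · rintro ⟨x, hx⟩ ⟨y, hy⟩ h
      simpa using h
    · rintro ⟨x, hx⟩ h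
      rw [incidence_of_not_isFacet o fun hx' => h ⟨⟨x, hx', hx⟩, rfl⟩]
      simp
  rw [e, pathSum, ← finsum_comp_equiv (Equiv.ofBijective _ (consPath_bijective hf pair hne)),
    finsum_eq_sum_of_fintype, Fintype.sum_sigma]
  refine Finset.sum_congr rfl fun α' _ => ?_
  rw [pathSum, finsum_eq_sum_of_fintype, Finset.mul_sum]
  rfl

/-- Summed over the boundary of the upper simplex of a gradient pair, the path sums cancel. -/
theorem sum_incidence_mul_pathSum [Finite K.faces] (hf : IsDiscreteMorse f) {α β ω : K.faces}
    (pair : IsGradientPair f α β) (hne : α ≠ ω) :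
    ∑ α' : K.faces, incidence o β α' * pathSum o f α' ω = 0 := by
  classical
  rw [Fintype.sum_eq_add_sum_subtype_ne _ α, pathSum_eq_sum o hf pair hne, Finset.mul_sum,
    ← Finset.sum_add_distrib]
  refine Finset.sum_eq_zero fun α' _ => ?_
  linear_combination (-incidence o β α' * pathSum o f α'.1 ω) * incidence_mul_self o pair.1

/-- Grouping the paths by their first face exhibits the Morse boundary as `reduction` applied to the
simplicial boundary. -/
theorem connectedness_eq_sum [Finite K.faces] (hf : IsDiscreteMorse f) (σ ω : K.faces) :
    connectedness o f σ ω = ∑ α : K.faces, incidence o σ α * pathSum o f α ω := by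
  classical
  have (α' : K.faces) : Fintype (GradientPath f α' ω) :=
    @Fintype.ofFinite _ (finite_gradientPath hf ω α')
  have e : ∑ α : K.faces, incidence o σ α * pathSum o f α ω =
      ∑ α : {α : K.faces // IsFacet α σ}, incidence o σ α * pathSum o f α.1 ω := by
    symm
    refine Fintype.sum_of_injective Subtype.val Subtype.val_injective _ _ ?_ fun _ => rfl
    intro x hx
    rw [incidence_of_not_isFacet o fun hx' => hx ⟨⟨x, hx'⟩, rfl⟩, zero_mul]
  have e' : connectedness o f σ ω =
      ∑ᶠ γ : (Σ α : {α : K.faces // IsFacet α σ}, GradientPath f α.1 ω),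
        incidence o σ γ.1.1 * γ.2.weight o := rfl
  rw [e, e', finsum_eq_sum_of_fintype, Fintype.sum_sigma]
  refine Finset.sum_congr rfl fun α' _ => ?_
  rw [pathSum, finsum_eq_sum_of_fintype, Finset.mul_sum]

end PathSum

/-! ### Chains of upper simplices and of critical simplices. -/

instance [Finite K.faces] (q : ℕ) : Finite (Simplex K q) :=
  inferInstanceAs (Finite {σ : K.faces // σ.1.card = q + 1})

instance [Finite K.faces] (f : K.faces → ℝ) (q : ℕ) : Finite (Crit f q) :=
  inferInstanceAs (Finite {σ : K.faces // σ.1.card = q + 1 ∧ IsCritical f σ})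

noncomputable instance [Finite K.faces] (q : ℕ) : Fintype (Simplex K q) := Fintype.ofFinite _

noncomputable instance [Finite K.faces] (f : K.faces → ℝ) (q : ℕ) : Fintype (Crit f q) :=
  Fintype.ofFinite _

/-- The `q`-chains supported on the upper simplices of gradient pairs. -/
def upperChains (f : K.faces → ℝ) (q : ℕ) : Submodule ℚ (SimplicialChain K q) :=
  Finsupp.supported ℚ ℚ {σ | ∃ α, IsGradientPair f α σ.1}

theorem exists_isGradientPair_of_mem_upperChains {f : K.faces → ℝ} {q : ℕ}
    {x : SimplicialChain K q} (hx : x ∈ upperChains f q) {σ : Simplex K q} (h : x σ ≠ 0) :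
    ∃ α, IsGradientPair f α σ.1 :=
  hx (Finsupp.mem_support_iff.mpr h)

theorem single_mem_upperChains {f : K.faces → ℝ} {q : ℕ} {α : K.faces} {σ : Simplex K q}
    (h : IsGradientPair f α σ.1) (r : ℚ) : Finsupp.single σ r ∈ upperChains f q :=
  Finsupp.single_mem_supported ℚ r ⟨α, h⟩

/-- A linear map vanishes on `upperChains f q` if it vanishes on the generators. -/
theorem map_eq_zero_of_mem_upperChains {f : K.faces → ℝ} {q : ℕ} {N : Type*} [AddCommGroup N]
    [Module ℚ N] {L : SimplicialChain K q →ₗ[ℚ] N}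
    (hL : ∀ (α : K.faces) (σ : Simplex K q), IsGradientPair f α σ.1 →
      L (Finsupp.single σ 1) = 0)
    {x : SimplicialChain K q} (hx : x ∈ upperChains f q) : L x = 0 := by
  rw [upperChains, Finsupp.supported_eq_span_single] at hx
  have : Submodule.span ℚ ((fun i => Finsupp.single i (1 : ℚ)) ''
      {σ : Simplex K q | ∃ α, IsGradientPair f α σ.1}) ≤ LinearMap.ker L := by
    rw [Submodule.span_le]
    rintro _ ⟨σ, ⟨α, h⟩, rfl⟩
    exact hL α σ h
  exact this hx

/-- The lower simplex of a pair is nonempty, so no vertex is an upper simplex. -/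
theorem upperChains_zero {f : K.faces → ℝ} {x : SimplicialChain K 0}
    (hx : x ∈ upperChains f 0) : x = 0 := by
  ext σ
  by_contra h
  obtain ⟨α, hα⟩ := exists_isGradientPair_of_mem_upperChains hx h
  have h1 := hα.1.2
  have h2 := σ.2
  have h3 := (K.isRelLowerSet_faces α.2).1.card_pos
  omega

/-- A critical simplex, viewed as a simplex. -/
def Crit.toSimplex {f : K.faces → ℝ} {q : ℕ} (σ : Crit f q) : Simplex K q := ⟨σ.1, σ.2.1⟩

/-- The inclusion of chains of critical simplices into all simplicial chains. -/
noncomputable def critInclusion (f : K.faces → ℝ) (q : ℕ) :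
    MorseChain f q →ₗ[ℚ] SimplicialChain K q :=
  Finsupp.lmapDomain ℚ ℚ Crit.toSimplex

theorem critInclusion_single {f : K.faces → ℝ} {q : ℕ} (σ : Crit f q) (r : ℚ) :
    critInclusion f q (Finsupp.single σ r) =
      Finsupp.single σ.toSimplex r :=
  Finsupp.mapDomain_single

/-! ### The boundary maps in coordinates. -/

variable [LinearOrder ι] [Finite K.faces] (o : Orientation K)

/-- The boundary map from `q + 1`-chains, with its target written as `q`-chains. -/
noncomputable abbrev succBoundary (q : ℕ) : SimplicialChain K (q + 1) →ₗ[ℚ] SimplicialChain K q :=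
  simplicialBoundary o (q + 1)

theorem simplicialBoundary_single {q : ℕ} (σ : Simplex K (q + 1)) :
    simplicialBoundary o (q + 1) (Finsupp.single σ 1) =
      ∑ α : Simplex K q, Finsupp.single α (incidence o σ.1 α.1 : ℚ) := by
  rw [simplicialBoundary, Finsupp.linearCombination_single, one_smul, finsum_eq_sum_of_fintype]

theorem morseBoundary_single (f : K.faces → ℝ) {q : ℕ} (σ : Crit f (q + 1)) :
    morseBoundary o f (q + 1) (Finsupp.single σ 1) =
      ∑ α : Crit f q, Finsupp.single α (connectedness o f σ.1 α.1 : ℚ) := by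
  rw [morseBoundary, Finsupp.linearCombination_single, one_smul, finsum_eq_sum_of_fintype]

theorem simplicialBoundary_apply {q : ℕ} (x : SimplicialChain K (q + 1)) (α : Simplex K q) :
    (simplicialBoundary o (q + 1) x : SimplicialChain K q) α =
      ∑ σ : Simplex K (q + 1), x σ * incidence o σ.1 α.1 := by
  classical
  rw [simplicialBoundary, Finsupp.linearCombination_apply, Finsupp.sum_fintype _ _ (by simp),
    Finsupp.finsetSum_apply]
  refine Finset.sum_congr rfl fun σ _ => ?_
  rw [finsum_eq_sum_of_fintype, Finsupp.smul_apply, Finsupp.finsetSum_apply, smul_eq_mul]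
  simp [Finsupp.single_apply]

theorem sum_incidence_mul {q : ℕ} (σ : Simplex K (q + 1)) (g : K.faces → ℤ) :
    ∑ α : Simplex K q, incidence o σ.1 α.1 * g α.1 =
      ∑ α : K.faces, incidence o σ.1 α * g α := by
  refine Fintype.sum_of_injective (fun α : Simplex K q => α.1) (fun _ _ h => Subtype.ext h) _ _ ?_
    fun _ => rfl
  intro α hα
  rw [incidence_of_not_isFacet o fun h => hα ⟨⟨α, ?_⟩, rfl⟩, zero_mul]
  have := h.2
  have := σ.2
  omega

theorem simplicialBoundary_simplicialBoundary (q : ℕ) (x : SimplicialChain K (q + 1)) :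
    simplicialBoundary o q (simplicialBoundary o (q + 1) x) = 0 := by
  cases q with
  | zero => rfl
  | succ q =>
    suffices h : (simplicialBoundary o (q + 1)).comp (simplicialBoundary o (q + 1 + 1)) = 0 from
      LinearMap.congr_fun h x
    refine Finsupp.lhom_ext' fun σ => LinearMap.ext_ring ?_
    ext τ
    simp only [LinearMap.comp_apply, Finsupp.lsingle_apply, LinearMap.zero_apply,
      Finsupp.zero_apply]
    rw [simplicialBoundary_single]
    refine (simplicialBoundary_apply o _ τ).trans ?_
    have h := sum_incidence_mul o σ fun α => incidence o α τ.1
    rw [sum_incidence_mul_incidence] at h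
    classical
    simp only [Finsupp.finsetSum_apply, Finsupp.single_apply, Finset.sum_ite_eq',
      Finset.mem_univ, if_true]
    exact_mod_cast h

/-! ### The reduction map to Morse chains. -/

variable (f : K.faces → ℝ)

/-- The map from simplicial chains to Morse chains that sends a simplex to the sum of the critical
simplices at the ends of gradient paths from it, with multiplicities. -/
noncomputable def reduction (q : ℕ) : SimplicialChain K q →ₗ[ℚ] MorseChain f q :=
  Finsupp.linearCombination ℚ fun α : Simplex K q =>
    ∑ ω : Crit f q, Finsupp.single ω (pathSum o f α.1 ω.1 : ℚ)

theorem reduction_single {q : ℕ} (σ : Simplex K q) : reduction o f q (Finsupp.single σ 1) =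
    ∑ ω : Crit f q, Finsupp.single ω (pathSum o f σ.1 ω.1 : ℚ) := by
  rw [reduction, Finsupp.linearCombination_single, one_smul]

theorem reduction_simplicialBoundary_single {q : ℕ} (σ : Simplex K (q + 1)) :
    reduction o f q (simplicialBoundary o (q + 1) (Finsupp.single σ 1)) =
      ∑ ω : Crit f q, Finsupp.single ω
        ((∑ α : K.faces, incidence o σ.1 α * pathSum o f α ω.1 : ℤ) : ℚ) := by
  rw [simplicialBoundary_single]
  refine (map_sum (reduction o f q) _ _).trans ?_
  simp only [reduction, Finsupp.linearCombination_single, Finset.smul_sum,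
    Finsupp.smul_single, smul_eq_mul]
  rw [Finset.sum_comm]
  refine Finset.sum_congr rfl fun ω _ => ?_
  rw [← sum_incidence_mul o σ fun α => pathSum o f α ω.1, Int.cast_sum, Finsupp.single_finsetSum]
  simp only [Int.cast_mul]

variable {f}

/-- A critical simplex is not the lower simplex of any pair, so only the constant path starts there.
-/
theorem reduction_critInclusion {q : ℕ} (x : MorseChain f q) :
    reduction o f q (critInclusion f q x) = x := by
  suffices h : (reduction o f q).comp (critInclusion f q) = LinearMap.id from
    LinearMap.congr_fun h x
  refine Finsupp.lhom_ext' fun σ => LinearMap.ext_ring ?_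
  have hσ := (isCritical_iff.mp σ.2.2).1
  simp only [LinearMap.comp_apply, Finsupp.lsingle_apply, LinearMap.id_apply]
  rw [critInclusion_single, reduction_single, Fintype.sum_eq_single σ]
  · exact congrArg (Finsupp.single σ) ((congrArg Int.cast (pathSum_self o hσ)).trans Int.cast_one)
  · intro ω hω
    have h0 : pathSum o f σ.toSimplex.1 ω.1 = 0 :=
      pathSum_of_ne o hσ fun h => hω (Subtype.ext h.symm)
    rw [h0, Int.cast_zero, Finsupp.single_zero]

theorem reduction_surjective (q : ℕ) : Function.Surjective (reduction o f q) :=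
  fun x => ⟨_, reduction_critInclusion o x⟩

theorem reduction_of_mem_upperChains (hf : IsDiscreteMorse f) {q : ℕ} {x : SimplicialChain K q}
    (hx : x ∈ upperChains f q) : reduction o f q x = 0 := by
  refine map_eq_zero_of_mem_upperChains (fun α σ h => ?_) hx
  rw [reduction_single]
  refine Finset.sum_eq_zero fun ω _ => ?_
  rw [pathSum_of_ne o fun β => h.not_isGradientPair hf, Int.cast_zero, Finsupp.single_zero]
  intro e
  exact (isCritical_iff.mp ω.2.2).2 α (e ▸ h)

theorem reduction_simplicialBoundary_of_mem_upperChains (hf : IsDiscreteMorse f) {q : ℕ}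
    {x : SimplicialChain K (q + 1)}
    (hx : x ∈ upperChains f (q + 1)) :
    reduction o f q (simplicialBoundary o (q + 1) x) = 0 := by
  refine map_eq_zero_of_mem_upperChains
    (L := (reduction o f q).comp (simplicialBoundary o (q + 1))) (fun α σ h => ?_) hx
  refine (reduction_simplicialBoundary_single o f σ).trans ?_
  refine Finset.sum_eq_zero fun ω _ => ?_
  rw [sum_incidence_mul_pathSum o hf h, Int.cast_zero, Finsupp.single_zero]
  intro e
  exact (isCritical_iff.mp ω.2.2).1 σ.1 (e ▸ h)

/-! ### Acyclicity of the kernel and the chain map property. -/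

/-- Triangularity of `∂` with respect to the matching: among the partners of the simplices in the
support of `x`, take `α` with `f α` maximal. Any other `σ` in the support with face `α` would have a
partner of larger value, so the coefficient of `∂ x` at `α` comes from the partner of `α` alone. -/
theorem eq_zero_of_simplicialBoundary_eq_zero (hf : IsDiscreteMorse f) {q : ℕ}
    {x : SimplicialChain K q}
    (hx : x ∈ upperChains f q) (h : simplicialBoundary o q x = 0) : x = 0 := by
  cases q with
  | zero => exact upperChains_zero hx
  | succ q =>
    by_contra hne
    obtain ⟨σ₀, hσ₀⟩ := Finsupp.ne_iff.mp hne
    have hS : {α : K.faces | ∃ σ, x σ ≠ 0 ∧ IsGradientPair f α σ.1}.Nonempty := by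
      obtain ⟨α, hα⟩ := exists_isGradientPair_of_mem_upperChains hx hσ₀
      exact ⟨α, σ₀, hσ₀, hα⟩
    obtain ⟨α, ⟨β, hβ, pair⟩, hmax⟩ := Set.exists_max_image _ f (Set.toFinite _) hS
    have hα : α.1.card = q + 1 := by
      have := pair.1.2
      have := β.2
      omega
    have hα' := simplicialBoundary_apply o x ⟨α, hα⟩
    rw [h, Fintype.sum_eq_single β] at hα'
    · refine mul_ne_zero hβ ?_ hα'.symm
      exact_mod_cast incidence_ne_zero o pair.1
    · intro σ hσ
      by_contra hne
      have hxσ := left_ne_zero_of_mul hne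
      have hface : IsFacet α σ.1 := by
        by_contra hn
        exact hne (by simp [incidence_of_not_isFacet o hn])
      obtain ⟨α', pair'⟩ := exists_isGradientPair_of_mem_upperChains hx hxσ
      refine (hmax α' ⟨σ, hxσ, pair'⟩).not_gt (lt_of_step hf pair' hface ?_)
      rintro rfl
      exact hσ (Subtype.ext (pair'.right_unique hf pair))

/-- Every chain is the sum of a chain of critical simplices, a chain of upper simplices of gradient
pairs, and the boundary of such a chain. -/
theorem exists_decomposition (hf : IsDiscreteMorse f) {q : ℕ} (x : SimplicialChain K q) :
    ∃ m, ∃ b ∈ upperChains f q, ∃ c ∈ upperChains f (q + 1),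
      x = critInclusion f q m + b + succBoundary o q c := by
  let d := succBoundary o q
  let W : Submodule ℚ (SimplicialChain K q) :=
    LinearMap.range (critInclusion f q) ⊔ upperChains f q ⊔ (upperChains f (q + 1)).map d
  suffices h : x ∈ W by
    obtain ⟨y, hy, _, ⟨c, hc, rfl⟩, rfl⟩ := Submodule.mem_sup.mp h
    obtain ⟨_, ⟨m, rfl⟩, b, hb, rfl⟩ := Submodule.mem_sup.mp hy
    exact ⟨m, b, hb, c, hc, rfl⟩
  have wf : WellFounded (fun a b : Simplex K q => f a.1 < f b.1) :=
    @Finite.wellFounded_of_trans_of_irrefl (Simplex K q) _ (fun a b => f a.1 < f b.1)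
      ⟨fun _ _ _ h h' => lt_trans h h'⟩ ⟨fun _ => lt_irrefl _⟩
  have hs : ∀ (α : Simplex K q) (r : ℚ), Finsupp.single α r ∈ W := by
    intro α
    induction α using wf.induction with
    | _ α ih =>
    intro r
    by_cases hup : ∃ ν, IsGradientPair f ν α.1
    · obtain ⟨ν, hν⟩ := hup
      exact Submodule.mem_sup_left (Submodule.mem_sup_right (single_mem_upperChains hν r))
    by_cases hlow : ∃ β, IsGradientPair f α.1 β
    · obtain ⟨β, pair⟩ := hlow
      let β' : Simplex K (q + 1) := ⟨β, by rw [pair.1.2, α.2]⟩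
      have hd : d (Finsupp.single β' 1) ∈ W :=
        Submodule.mem_sup_right ⟨_, single_mem_upperChains pair 1, rfl⟩
      have hd' : d (Finsupp.single β' 1) =
          ∑ α' : Simplex K q, Finsupp.single α' (incidence o β α'.1 : ℚ) :=
        simplicialBoundary_single o β'
      classical
      -- The faces of `β` other than `α` have smaller `f`-value, so modulo `W` the boundary of `β`
      -- is a nonzero multiple of `α`.
      rw [hd', Fintype.sum_eq_add_sum_subtype_ne _ α] at hd
      have hα : Finsupp.single α (incidence o β α.1 : ℚ) ∈ W := by
        refine (Submodule.add_mem_iff_left W (Submodule.sum_mem _ fun α' _ => ?_)).mp hd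
        by_cases face : IsFacet α'.1.1 β
        · exact ih _ (lt_of_step hf pair face fun e => α'.2 (Subtype.ext e)) _
        · rw [incidence_of_not_isFacet o face, Int.cast_zero, Finsupp.single_zero]
          exact zero_mem _
      have h0 : (incidence o β α.1 : ℚ) ≠ 0 := by
        exact_mod_cast incidence_ne_zero o pair.1
      have := W.smul_mem (r * (incidence o β α.1 : ℚ)⁻¹) hα
      rwa [Finsupp.smul_single, smul_eq_mul, inv_mul_cancel_right₀ h0] at this
    · push Not at hup hlow
      refine Submodule.mem_sup_left (Submodule.mem_sup_left
        ⟨Finsupp.single ⟨α.1, α.2, isCritical_iff.mpr ⟨hlow, hup⟩⟩ r, critInclusion_single _ r⟩)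
  rw [← Finsupp.sum_single x]
  exact Submodule.sum_mem _ fun α _ => hs α _

theorem morseBoundary_critInclusion (hf : IsDiscreteMorse f) {q : ℕ} (m : MorseChain f (q + 1)) :
    morseBoundary o f (q + 1) m =
      reduction o f q (simplicialBoundary o (q + 1) (critInclusion f (q + 1) m)) := by
  suffices h : morseBoundary o f (q + 1) = (reduction o f q).comp
      ((simplicialBoundary o (q + 1)).comp (critInclusion f (q + 1))) from
    LinearMap.congr_fun h m
  refine Finsupp.lhom_ext' fun σ => LinearMap.ext_ring ?_
  simp only [LinearMap.comp_apply, Finsupp.lsingle_apply]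
  rw [critInclusion_single]
  refine (morseBoundary_single o f σ).trans
    (Eq.trans ?_ (reduction_simplicialBoundary_single o f _).symm)
  refine Finset.sum_congr rfl fun ω _ => ?_
  rw [connectedness_eq_sum o hf]
  rfl

/-- `reduction` is a chain map. -/
theorem morseBoundary_reduction (hf : IsDiscreteMorse f) (q : ℕ) (x : SimplicialChain K q) :
    morseBoundary o f q (reduction o f q x) =
      reduction o f (q - 1) (simplicialBoundary o q x) := by
  cases q with
  | zero => exact (map_zero (reduction o f 0)).symm
  | succ q =>
    -- Both sides vanish on `b` and on the boundary of `c`, leaving only the critical part.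
    obtain ⟨m, b, hb, c, hc, rfl⟩ := exists_decomposition o hf x
    have h1 : reduction o f (q + 1) (succBoundary o (q + 1) c) = 0 :=
      reduction_simplicialBoundary_of_mem_upperChains o hf hc
    have h2 : simplicialBoundary o (q + 1) (succBoundary o (q + 1) c) = 0 :=
      simplicialBoundary_simplicialBoundary o (q + 1) c
    have h3 : reduction o f (q + 1 - 1) (simplicialBoundary o (q + 1) b) = 0 :=
      reduction_simplicialBoundary_of_mem_upperChains o hf hb
    have h4 := morseBoundary_critInclusion o hf m
    have h5 := reduction_critInclusion o m
    have h6 := reduction_of_mem_upperChains o hf hb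
    simp only [map_add, h1, h2, h3, h5, h6, add_zero]
    exact h4

/-- This is acyclicity of the kernel. In the decomposition of `x`, applying `reduction` isolates the
critical part, which is therefore zero; then `∂ b = 0` forces `b = 0`, and `x` is the boundary of an
upper chain. -/
theorem exists_of_reduction_eq_zero (hf : IsDiscreteMorse f) {q : ℕ} {x : SimplicialChain K q}
    (hx : reduction o f q x = 0) (hd : simplicialBoundary o q x = 0) :
    ∃ c, reduction o f (q + 1) c = 0 ∧ simplicialBoundary o (q + 1) c = x := by
  obtain ⟨m, b, hb, c, hc, rfl⟩ := exists_decomposition o hf x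
  have h1 : reduction o f q (succBoundary o q c) = 0 :=
    reduction_simplicialBoundary_of_mem_upperChains o hf hc
  have h2 : simplicialBoundary o q (succBoundary o q c) = 0 :=
    simplicialBoundary_simplicialBoundary o q c
  have hm : m = 0 := by
    have h := (map_add (reduction o f q) _ _).symm.trans hx
    rwa [h1, map_add, reduction_critInclusion, reduction_of_mem_upperChains o hf hb, add_zero,
      add_zero] at h
  subst hm
  rw [map_zero, zero_add] at hd ⊢
  have hb0 : b = 0 := by
    refine eq_zero_of_simplicialBoundary_eq_zero o hf hb ?_
    have h := (map_add (simplicialBoundary o q) _ _).symm.trans hd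
    rwa [h2, add_zero] at h
  exact ⟨c, reduction_of_mem_upperChains o hf hc, by rw [hb0]; exact (zero_add _).symm⟩

end DiscreteMorse

theorem theorem5p1 {ι : Type*} [LinearOrder ι] (K : PreAbstractSimplicialComplex ι)
    [Finite K.faces] (o : DiscreteMorse.Orientation K)
    (f : K.faces → ℝ) (hf : DiscreteMorse.IsDiscreteMorse f) :
    (∀ q : ℕ, DiscreteMorse.morseBoundary o f q ∘ₗ DiscreteMorse.morseBoundary o f (q + 1) = 0) ∧
    (∀ q : ℕ, Nonempty
      (DiscreteMorse.MorseHomology o f q ≃ₗ[ℚ] DiscreteMorse.SimplicialHomology o q)) := by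
  open DiscreteMorse in
  constructor
  · intro q
    refine LinearMap.ext fun y => ?_
    obtain ⟨x, rfl⟩ := reduction_surjective o (q + 1) y
    have h1 := morseBoundary_reduction o hf (q + 1) x
    have h2 := morseBoundary_reduction o hf q (simplicialBoundary o (q + 1) x)
    rw [simplicialBoundary_simplicialBoundary, map_zero] at h2
    exact (congrArg (morseBoundary o f q) h1).trans h2
  · intro q
    refine nonempty_homology_equiv (r₂ := reduction o f (q + 1)) (r₁ := reduction o f q)
      (r₀ := reduction o f (q - 1)) (morseBoundary_reduction o hf (q + 1))
      (morseBoundary_reduction o hf q) (reduction_surjective o _) (reduction_surjective o _)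
      (simplicialBoundary_simplicialBoundary o q)
      (fun x hx hd => exists_of_reduction_eq_zero o hf hx hd) ?_
    intro x hx
    -- The index `q - 1` truncates at zero: in degree `0` the boundary vanishes and the witness is
    -- `0`, while in positive degree the boundary of `x` is a cycle in the acyclic kernel.
    cases q with
    | zero => exact ⟨0, map_zero _, map_zero _⟩
    | succ q =>
      exact exists_of_reduction_eq_zero o hf hx (simplicialBoundary_simplicialBoundary o q x)
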